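/- Let $n\in\mathbb{N}$, let $r>0$ be real, let $u=(u_1,\dots,u_n)$ be a vector of positive integers, and let $N=\{1,\dots,n\}$. Define the bounded mixed-integer bilinear covering set $$S^U=\Bigl\{(x,y)\in\mathbb{Z}^n_+\times\mathbb{R}^n_+ : \sum_{i=1}^n x_iy_i\ge r,\ x\le u\Bigr\}.$$ For $i\in N$ let $$S^L_i=\Bigl\{(x,y)\in\mathbb{Z}^n_+\times\mathbb{R}^n_+ : x_j=y_j=0\ \text{for all } j\ne i,\ x_iy_i\ge r,\ y_i\ge \tfrac{r}{u_i}\Bigr\},\qquad S^L=\bigcup_{i=1}^n S^L_i .$$ For $i\in N$ put $K_i=\{1,\dots,u_i\}$ and $\bar K_i=K_i\cup\{u_i+1\}$, and define linear forms on $\mathbb{R}^2$, depending on $i$ and on $k_i\in\bar K_i$, by $$l^{k_i}(x_i,y_i)=\frac{x_i}{2k_i-1}+\frac{k_i(k_i-1)}{r(2k_i-1)}\,y_i\quad(k_i\in K_i),\qquad l^{u_i+1}(x_i,y_i)=\frac{y_i}{r/u_i}.$$ Then $$\operatorname{conv}(S^U)=\operatorname{cl}\bigl(\operatorname{conv}(S^L)\bigr)\cap\{(x,y)\in\mathbb{R}^n_+\times\mathbb{R}^n_+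 : x\le u\},$$ and $$\operatorname{conv}(S^U)=\Bigl\{(x,y)\in\mathbb{R}^n\times\mathbb{R}^n : \sum_{i=1}^n l^{k_i}(x_i,y_i)\ge 1\ \ \forall (k_i)_{i=1}^n\in\prod_{i=1}^n\bar K_i,\ \ 0\le x\le u,\ \ y\ge 0\Bigr\}.$$ -/

import Mathlib

noncomputable section

/-- The space `ℝⁿ × ℝⁿ` of pairs `(x, y)`. -/
abbrev PairSpace (n : ℕ) : Type := (Fin n → ℝ) × (Fin n → ℝ)

/-- The bounded covering set `S^U`: `x` is a nonnegative integer vector with `x ≤ u`,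
`y ≥ 0` is real, and `∑ xᵢ yᵢ ≥ r`. -/
def boundedCoveringSet {n : ℕ} (r : ℝ) (u : Fin n → ℕ) : Set (PairSpace n) :=
  {p | (∀ i, ∃ m : ℕ, p.1 i = (m : ℝ)) ∧ (∀ i, 0 ≤ p.2 i) ∧
    r ≤ ∑ i, p.1 i * p.2 i ∧ ∀ i, p.1 i ≤ (u i : ℝ)}

/-- The orthogonal set `S^L_i`: all coordinates except `(xᵢ, yᵢ)` vanish, `xᵢ` is a nonnegative
integer, `yᵢ ≥ 0`, `xᵢ yᵢ ≥ r` and `yᵢ ≥ r / uᵢ`. -/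
def lowerBoundedSlice {n : ℕ} (r : ℝ) (u : Fin n → ℕ) (i : Fin n) : Set (PairSpace n) :=
  {p | (∀ j, j ≠ i → p.1 j = 0 ∧ p.2 j = 0) ∧ (∃ m : ℕ, p.1 i = (m : ℝ)) ∧ 0 ≤ p.2 i ∧
    r ≤ p.1 i * p.2 i ∧ r / (u i : ℝ) ≤ p.2 i}

/-- `S^L`, the union of the sets `S^L_i`. -/
def lowerBoundedSet {n : ℕ} (r : ℝ) (u : Fin n → ℕ) : Set (PairSpace n) :=
  ⋃ i, lowerBoundedSlice r u i

/-- The box `0 ≤ x ≤ u`, `y ≥ 0`. -/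
def boundBox {n : ℕ} (u : Fin n → ℕ) : Set (PairSpace n) :=
  {p | (∀ i, 0 ≤ p.1 i) ∧ (∀ i, 0 ≤ p.2 i) ∧ ∀ i, p.1 i ≤ (u i : ℝ)}

/-- The index set `{1, …, v} ∪ {v + 1}`. -/
def facetIndex (v : ℕ) : Finset ℕ := Finset.Icc 1 v ∪ {v + 1}

/-- The linear form `l^k` attached to a bound `v`: for `k ∈ {1, …, v}` it is
`x / (2k - 1) + k (k - 1) y / (r (2k - 1))`, and for `k = v + 1` it is `y / (r / v)`. -/
def facetForm (r : ℝ) (v k : ℕ) (x y : ℝ) : ℝ :=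
  if k = v + 1 then y / (r / (v : ℝ))
  else 1 / (2 * (k : ℝ) - 1) * x + (k : ℝ) * ((k : ℝ) - 1) / (r * (2 * (k : ℝ) - 1)) * y

end

/-!
The three sets are compared in a cycle: the convex hull of the covering set lies in
`closure (convexHull ℝ (lowerBoundedSet r u)) ∩ boundBox u`, that intersection lies in the polyhedron
cut out by the linear forms, and the polyhedron lies in the convex hull of the covering set.

* For the first inclusion, the closed convex hull `K` of `lowerBoundedSet r u` is an upper set: it
  recedes along every coordinate direction (`mem_closure_convexHull_lowerBoundedSet_of_le`). A point
  `(x, y)` of the covering set dominates the convex combination, with weights `xᵢ yᵢ / ∑ xⱼ yⱼ`, of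
  the points of the slices with coordinates `(xᵢ, r / xᵢ)`, so it belongs to `K`.
* For the second inclusion, every form is at least `1` on the slices
  (`one_le_facetForm_of_natCast`), because `(m - k) (m - k + 1) ≥ 0` for integers, and a half-space
  is closed and convex.
* For the third inclusion, let `gᵢ` be the least value at `(xᵢ, yᵢ)` of the forms with index `i`, and
  rescale the `gᵢ` to `tᵢ ≤ gᵢ` with `∑ tᵢ = 1`. A planar computation
  (`exists_mem_convexHull_planarVertices`) shows that `(xᵢ, yᵢ)` lies above a convex combination of
  the points `tᵢ (k, r / k)`, `1 ≤ k ≤ uᵢ`, and the point `(uᵢ, tᵢ r / uᵢ)`. As convex hulls commute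
  with products, it remains to treat a point all of whose coordinate pairs are of these two kinds.
  It is the average, with weights `tⱼ`, of the following points of the covering set: the `j`-th has
  the single nonzero entry `yⱼ = r / kⱼ` in `y`, while in `x` the coordinates of the second kind are
  kept at `uᵢ`, the `j`-th one is `kⱼ`, and the others vanish (`vertex_mem_convexHull`). Here `kⱼ = uⱼ`
  if the `j`-th pair is of the second kind.
-/

/-! ### The closed convex hull of the orthogonal set -/

/-- A closed convex set that contains one discrete ray in the direction `d` recedes along `d` from
each of its points. -/
lemma add_smul_mem_of_forall_natCast_smul_mem {E : Type*} [AddCommGroup E] [Module ℝ E]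
    [TopologicalSpace E] [IsTopologicalAddGroup E] [ContinuousSMul ℝ E] {K : Set E}
    (hK : Convex ℝ K) (hKc : IsClosed K) {p s d : E} (hp : p ∈ K)
    (hs : ∀ N : ℕ, s + (N : ℝ) • d ∈ K) {c : ℝ} (hc : 0 ≤ c) : p + c • d ∈ K := by
  have hlim : Filter.Tendsto (fun N : ℕ => p + c • d + (c / (N : ℝ)) • (s - p)) Filter.atTop
      (nhds (p + c • d + (0 : ℝ) • (s - p))) :=
    tendsto_const_nhds.add ((tendsto_const_div_atTop_nhds_zero_nat c).smul_const _)
  rw [zero_smul, add_zero] at hlim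
  refine hKc.mem_of_tendsto hlim ?_
  filter_upwards [Filter.eventually_ge_atTop (⌈c⌉₊ + 1)] with N hN
  have hN0 : (0 : ℝ) < N := by
    have : 0 < N := by omega
    exact_mod_cast this
  have hcN : c ≤ N := (Nat.le_ceil c).trans (by exact_mod_cast (by omega : ⌈c⌉₊ ≤ N))
  have h1 : c / (N : ℝ) ≤ 1 := (div_le_one hN0).2 hcN
  -- The approximating point is a convex combination of `p` and `s + N • d`.
  have h := hK hp (hs N) (sub_nonneg.2 h1) (div_nonneg hc hN0.le) (by ring)
  convert h using 1
  rw [smul_add, smul_smul, div_mul_cancel₀ c hN0.ne', sub_smul, one_smul, smul_sub]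
  abel

lemma single_mem_lowerBoundedSet {n : ℕ} {r : ℝ} {u : Fin n → ℕ} (i : Fin n) (m : ℕ) {y : ℝ}
    (hy : 0 ≤ y) (hr : r ≤ m * y) (hyu : r / (u i : ℝ) ≤ y) :
    ((Pi.single i (m : ℝ), Pi.single i y) : PairSpace n) ∈ lowerBoundedSet r u := by
  refine Set.mem_iUnion.2 ⟨i, fun j hj => ?_, ⟨m, by simp⟩, by simpa, by simpa, by simpa⟩
  simp [hj]

lemma mem_closure_convexHull_lowerBoundedSet_of_le {n : ℕ} {r : ℝ} (hr : 0 < r) {u : Fin n → ℕ}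
    (hu : ∀ i, 0 < u i) {p q : PairSpace n}
    (hp : p ∈ closure (convexHull ℝ (lowerBoundedSet r u))) (hpq : p ≤ q) :
    q ∈ closure (convexHull ℝ (lowerBoundedSet r u)) := by
  set K := closure (convexHull ℝ (lowerBoundedSet r u)) with hKdef
  have hK : Convex ℝ K := (convex_convexHull ℝ _).closure
  have hKc : IsClosed K := isClosed_closure
  have hsub : lowerBoundedSet r u ⊆ K := (subset_convexHull ℝ _).trans subset_closure
  have hx : ∀ p ∈ K, ∀ i : Fin n, ∀ a : ℝ, 0 ≤ a →
      p + a • ((Pi.single i 1, 0) : PairSpace n) ∈ K := by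
    intro p hp i a ha
    have hui : (0 : ℝ) < u i := by exact_mod_cast hu i
    refine add_smul_mem_of_forall_natCast_smul_mem hK hKc hp
      (s := (Pi.single i (u i : ℝ), Pi.single i (r / u i))) (fun N => ?_) ha
    have h := single_mem_lowerBoundedSet (r := r) (u := u) i (u i + N) (y := r / u i) (by positivity)
      (by
        push_cast
        rw [add_mul, mul_div_cancel₀ r hui.ne']
        have : (0 : ℝ) ≤ N * (r / u i) := by positivity
        linarith) le_rfl
    convert hsub h using 1
    ext j <;> by_cases hj : j = i <;> simp [hj]
  have hy : ∀ p ∈ K, ∀ i : Fin n, ∀ a : ℝ, 0 ≤ a →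
      p + a • ((0, Pi.single i 1) : PairSpace n) ∈ K := by
    intro p hp i a ha
    have hui : (0 : ℝ) < u i := by exact_mod_cast hu i
    refine add_smul_mem_of_forall_natCast_smul_mem hK hKc hp
      (s := (Pi.single i (u i : ℝ), Pi.single i (r / u i))) (fun N => ?_) ha
    have hN : (0 : ℝ) ≤ u i * N := by positivity
    have h := single_mem_lowerBoundedSet (r := r) (u := u) i (u i) (y := r / u i + N)
      (by positivity)
      (by
        rw [mul_add, mul_div_cancel₀ r hui.ne']
        linarith) (by simp)
    convert hsub h using 1
    ext j <;> by_cases hj : j = i <;> simp [hj]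
  have hsum : ∀ s : Finset (Fin n), p + ∑ i ∈ s, ((q.1 i - p.1 i) • ((Pi.single i 1, 0) : PairSpace n)
      + (q.2 i - p.2 i) • ((0, Pi.single i 1) : PairSpace n)) ∈ K := by
    intro s
    induction s using Finset.induction_on with
    | empty => simpa using hp
    | insert i s hi ih =>
      rw [Finset.sum_insert hi, add_comm (_ + _) (Finset.sum _ _), ← add_assoc, ← add_assoc]
      exact hy _ (hx _ ih i _ (sub_nonneg.2 (hpq.1 i))) i _ (sub_nonneg.2 (hpq.2 i))
  convert hsum Finset.univ using 1
  ext j <;> simp [Prod.fst_sum, Prod.snd_sum, Pi.single_apply]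

lemma boundedCoveringSet_subset_closure {n : ℕ} {r : ℝ} (hr : 0 < r) {u : Fin n → ℕ}
    (hu : ∀ i, 0 < u i) :
    boundedCoveringSet r u ⊆ closure (convexHull ℝ (lowerBoundedSet r u)) := by
  rintro p ⟨hx, hy, hsum, hxu⟩
  choose x hx using hx
  set S := ∑ i, p.1 i * p.2 i with hS
  have hS0 : 0 < S := hr.trans_le hsum
  have hprod : ∀ i, 0 ≤ p.1 i * p.2 i := fun i => mul_nonneg (by rw [hx]; positivity) (hy i)
  -- Where `xᵢ = 0` the weight is zero, and any point of the slice will do.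
  let m : Fin n → ℕ := fun i => if x i = 0 then u i else x i
  have hm0 : ∀ i, (0 : ℝ) < m i := fun i => by
    have := hu i
    have : 0 < m i := by simp only [m]; split_ifs <;> omega
    exact_mod_cast this
  have hmu : ∀ i, (m i : ℝ) ≤ u i := fun i => by
    by_cases h : x i = 0
    · simp [m, h]
    · simpa [m, h, ← hx i] using hxu i
  have hw1 : ∑ i, p.1 i * p.2 i / S = 1 := by
    rw [← Finset.sum_div, ← hS, div_self hS0.ne']
  have hmem : ∑ i, (p.1 i * p.2 i / S) •
      ((Pi.single i (m i : ℝ), Pi.single i (r / m i)) : PairSpace n) ∈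
        convexHull ℝ (lowerBoundedSet r u) := by
    refine (convex_convexHull ℝ _).sum_mem (fun i _ => div_nonneg (hprod i) hS0.le) hw1
      fun i _ => subset_convexHull ℝ _ (single_mem_lowerBoundedSet i (m i) ?_ ?_ ?_)
    · exact div_nonneg hr.le (hm0 i).le
    · rw [mul_div_cancel₀ r (hm0 i).ne']
    · exact div_le_div_of_nonneg_left hr.le (hm0 i) (hmu i)
  refine mem_closure_convexHull_lowerBoundedSet_of_le hr hu (subset_closure hmem) ⟨fun j => ?_,
    fun j => ?_⟩
  · have hle : p.1 j * p.2 j / S ≤ 1 := by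
      rw [div_le_one hS0]
      exact Finset.single_le_sum (fun i _ => hprod i) (Finset.mem_univ j)
    simp only [Prod.fst_sum, Prod.smul_fst, Finset.sum_apply, Pi.smul_apply, Pi.single_apply,
      smul_eq_mul, mul_ite, mul_zero, Finset.sum_ite_eq, Finset.mem_univ, if_true]
    by_cases h : x j = 0
    · simp [hx j, h]
    · simp only [m, h, if_false]
      rw [← hx j]
      exact mul_le_of_le_one_left (by rw [hx]; positivity) hle
  · simp only [Prod.snd_sum, Prod.smul_snd, Finset.sum_apply, Pi.smul_apply, Pi.single_apply,
      smul_eq_mul, mul_ite, mul_zero, Finset.sum_ite_eq, Finset.mem_univ, if_true]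
    by_cases h : x j = 0
    · simpa [hx j, h] using hy j
    · have hmx : (m j : ℝ) = p.1 j := by simp [m, h, hx j]
      have hp0 : 0 < p.1 j := hmx ▸ hm0 j
      rw [hmx, div_mul_div_comm, div_le_iff₀ (mul_pos hS0 hp0)]
      have := mul_le_mul_of_nonneg_left hsum (hprod j)
      linarith

lemma convex_boundBox {n : ℕ} (u : Fin n → ℕ) : Convex ℝ (boundBox u) := by
  have h : boundBox u = Set.Icc 0 (fun i => (u i : ℝ)) ×ˢ Set.Ici 0 := by
    ext p
    simp only [boundBox, Set.mem_ofPred_eq, Set.mem_prod, Set.mem_Icc, Set.mem_Ici, Pi.le_def,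
      Pi.zero_apply]
    tauto
  rw [h]
  exact (convex_Icc _ _).prod (convex_Ici _)

/-! ### Validity of the linear inequalities -/

lemma mem_facetIndex {v k : ℕ} : k ∈ facetIndex v ↔ 1 ≤ k ∧ k ≤ v + 1 := by
  simp only [facetIndex, Finset.mem_union, Finset.mem_Icc, Finset.mem_singleton]
  omega

lemma facetForm_nonneg {r : ℝ} (hr : 0 < r) {v k : ℕ} (hk : k ∈ facetIndex v) {x y : ℝ}
    (hx : 0 ≤ x) (hy : 0 ≤ y) : 0 ≤ facetForm r v k x y := by
  have hk1 : (1 : ℝ) ≤ k := by exact_mod_cast (mem_facetIndex.1 hk).1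
  have h1 : (0 : ℝ) ≤ k - 1 := by linarith
  have h2 : (0 : ℝ) < 2 * k - 1 := by linarith
  unfold facetForm
  split_ifs <;> positivity

lemma one_le_facetForm_of_natCast {r : ℝ} (hr : 0 < r) {v k : ℕ} (hv : 0 < v)
    (hk : k ∈ facetIndex v) {m : ℕ} {y : ℝ} (hmy : r ≤ m * y) (hy : r / (v : ℝ) ≤ y) :
    1 ≤ facetForm r v k m y := by
  have hk1 : (1 : ℝ) ≤ k := by exact_mod_cast (mem_facetIndex.1 hk).1
  have hv0 : (0 : ℝ) < v := by exact_mod_cast hv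
  have h2 : (0 : ℝ) < 2 * k - 1 := by linarith
  unfold facetForm
  split_ifs
  · rwa [one_le_div (by positivity)]
  · have hm : (0 : ℝ) < m := by
      rcases Nat.eq_zero_or_pos m with rfl | h
      · norm_num at hmy
        linarith
      · exact_mod_cast h
    -- No integer lies strictly between `k - 1` and `k`.
    have hint : (0 : ℝ) ≤ ((m : ℝ) - k) * (m - k + 1) := by
      rcases le_or_gt k m with h | h
      · have : (k : ℝ) ≤ m := by exact_mod_cast h
        exact mul_nonneg (by linarith) (by linarith)
      · have : (m : ℝ) + 1 ≤ k := by exact_mod_cast h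
        exact mul_nonneg_of_nonpos_of_nonpos (by linarith) (by linarith)
    have hkk : (0 : ℝ) ≤ k * (k - 1) := mul_nonneg (by linarith) (by linarith)
    have hform : 1 / (2 * (k : ℝ) - 1) * m + (k : ℝ) * (k - 1) / (r * (2 * k - 1)) * y
        = (m * (m * r) + k * (k - 1) * (m * y)) / (m * (r * (2 * k - 1))) := by
      field_simp
    rw [hform, one_le_div (by positivity)]
    have h3 := mul_le_mul_of_nonneg_left hmy hkk
    have h4 := mul_nonneg hr.le hint
    nlinarith

/-- The form is linear in `(x, y)`, with coefficients its values at the unit vectors. -/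
lemma facetForm_eq_linear (r : ℝ) (v k : ℕ) (x y : ℝ) :
    facetForm r v k x y = facetForm r v k 1 0 * x + facetForm r v k 0 1 * y := by
  unfold facetForm
  split_ifs <;> ring

lemma one_le_sum_facetForm_of_mem_closure {n : ℕ} {r : ℝ} (hr : 0 < r) {u : Fin n → ℕ}
    (hu : ∀ i, 0 < u i) {k : Fin n → ℕ} (hk : ∀ i, k i ∈ facetIndex (u i)) {p : PairSpace n}
    (hp : p ∈ closure (convexHull ℝ (lowerBoundedSet r u))) :
    1 ≤ ∑ i, facetForm r (u i) (k i) (p.1 i) (p.2 i) := by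
  let f : PairSpace n → ℝ := fun p => ∑ i, facetForm r (u i) (k i) (p.1 i) (p.2 i)
  have hf : f = fun p => ∑ i, (facetForm r (u i) (k i) 1 0 * p.1 i
      + facetForm r (u i) (k i) 0 1 * p.2 i) := by
    funext p
    exact Finset.sum_congr rfl fun i _ => facetForm_eq_linear ..
  have hlin : IsLinearMap ℝ f := by
    rw [hf]
    constructor
    · intro p q
      rw [← Finset.sum_add_distrib]
      refine Finset.sum_congr rfl fun i _ => ?_
      simp only [Prod.fst_add, Prod.snd_add, Pi.add_apply]
      ring
    · intro c p
      rw [smul_eq_mul, Finset.mul_sum]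
      refine Finset.sum_congr rfl fun i _ => ?_
      simp only [Prod.smul_fst, Prod.smul_snd, Pi.smul_apply, smul_eq_mul]
      ring
  have hcont : Continuous f := by
    rw [hf]
    fun_prop
  have hsub : lowerBoundedSet r u ⊆ {p | 1 ≤ f p} := by
    intro q hq
    obtain ⟨i, hq0, ⟨m, hm⟩, -, hmy, hyu⟩ := Set.mem_iUnion.1 hq
    have hfq : f q = facetForm r (u i) (k i) (q.1 i) (q.2 i) :=
      Finset.sum_eq_single_of_mem i (Finset.mem_univ i) fun j _ hj => by
        rw [facetForm_eq_linear, (hq0 j hj).1, (hq0 j hj).2]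
        ring
    rw [Set.mem_ofPred_eq, hfq, hm]
    exact one_le_facetForm_of_natCast hr (hu i) (hk i) (hm ▸ hmy) hyu
  exact closure_minimal (convexHull_min hsub (convex_halfSpace_ge hlin 1))
    (isClosed_le continuous_const hcont) hp

/-! ### The planar region -/

/-- The points `t (m, r / m)` with `1 ≤ m ≤ v`, together with `(v, t r / v)`. -/
def planarVertices (r : ℝ) (v : ℕ) (t : ℝ) : Set (ℝ × ℝ) :=
  {q | ∃ m : ℕ, 0 < m ∧ m ≤ v ∧ q.2 = t * (r / m) ∧ (q.1 = t * m ∨ m = v ∧ q.1 = v)}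

/-- The region where all forms are at least `t` lies above the convex hull of
`planarVertices r v t`. -/
lemma exists_mem_convexHull_planarVertices {r : ℝ} (hr : 0 < r) {v : ℕ} (hv : 0 < v) {t : ℝ}
    (ht : 0 ≤ t) {x y : ℝ} (hxv : x ≤ v) (hform : ∀ k ∈ facetIndex v, t ≤ facetForm r v k x y) :
    ∃ z ≤ y, (x, z) ∈ convexHull ℝ (planarVertices r v t) := by
  have hv0 : (0 : ℝ) < v := by exact_mod_cast hv
  have hconv := convex_convexHull ℝ (planarVertices r v t)
  have hvert : ∀ m : ℕ, 0 < m → m ≤ v → (t * m, t * (r / m)) ∈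
      convexHull ℝ (planarVertices r v t) :=
    fun m h0 hm => subset_convexHull ℝ _ ⟨m, h0, hm, rfl, Or.inl rfl⟩
  have hxt : t ≤ x := by
    have h := hform 1 (mem_facetIndex.2 ⟨le_rfl, by omega⟩)
    rw [facetForm, if_neg (by omega)] at h
    norm_num at h
    exact h
  have hyt : t * (r / v) ≤ y := by
    have h := hform (v + 1) (mem_facetIndex.2 ⟨by omega, le_rfl⟩)
    rw [facetForm, if_pos rfl] at h
    rwa [le_div_iff₀ (by positivity)] at h
  rcases le_or_gt (t * v) x with hx | hx
  · refine ⟨t * (r / v), hyt, ?_⟩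
    have hright : ((v : ℝ), t * (r / v)) ∈ convexHull ℝ (planarVertices r v t) :=
      subset_convexHull ℝ _ ⟨v, hv, le_rfl, rfl, Or.inr ⟨rfl, rfl⟩⟩
    obtain ⟨a, b, ha, hb, hab, hxab⟩ := (Convex.mem_Icc (hx.trans hxv)).1 ⟨hx, hxv⟩
    convert hconv (hvert v hv le_rfl) hright ha hb hab using 1
    ext
    · exact hxab.symm
    · simp only [Prod.snd_add, Prod.smul_snd, smul_eq_mul]
      rw [← add_mul, hab, one_mul]
  · have ht0 : 0 < t := by
      rcases ht.eq_or_lt with rfl | h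
      · rw [zero_mul] at hx
        linarith
      · exact h
    -- `(x, y)` lies above the edge from `t (m, r / m)` to `t (m + 1, r / (m + 1))`.
    set m := ⌊x / t⌋₊ with hm
    have hm1 : 1 ≤ m := Nat.le_floor (by rw [Nat.cast_one, one_le_div ht0]; exact hxt)
    have hmx : t * m ≤ x := by
      have := Nat.floor_le (div_nonneg (ht.trans hxt) ht)
      rw [le_div_iff₀ ht0] at this
      linarith
    have hxm : x ≤ t * (m + 1 : ℕ) := by
      have := (Nat.lt_floor_add_one (x / t)).le
      rw [div_le_iff₀ ht0] at this
      push_cast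
      linarith
    have hmv : m + 1 ≤ v := by
      have : (m : ℝ) < v := lt_of_mul_lt_mul_left (hmx.trans_lt hx) ht
      exact_mod_cast this
    have hm0 : (0 : ℝ) < m := by exact_mod_cast hm1
    obtain ⟨a, b, ha, hb, hab, hxab⟩ := (Convex.mem_Icc (hmx.trans hxm)).1 ⟨hmx, hxm⟩
    refine ⟨a * (t * (r / m)) + b * (t * (r / (m + 1 : ℕ))), ?_, ?_⟩
    · have h := hform (m + 1) (mem_facetIndex.2 ⟨by omega, by omega⟩)
      rw [facetForm, if_neg (by omega)] at h
      obtain rfl : a = 1 - b := by linarith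
      push_cast at h hxab ⊢
      have h2 : (0 : ℝ) < 2 * (m + 1) - 1 := by linarith
      have hx' : x = t * (m + b) := by rw [← hxab]; ring
      have he : 1 / (2 * ((m : ℝ) + 1) - 1) * x
          + ((m : ℝ) + 1) * (m + 1 - 1) / (r * (2 * (m + 1) - 1)) * y
          = (r * x + (m + 1) * m * y) / (r * (2 * (m + 1) - 1)) := by
        field_simp
        ring
      rw [he, le_div_iff₀ (by positivity), hx'] at h
      have he2 : (1 - b) * (t * (r / m)) + b * (t * (r / (m + 1)))
          = t * r * (m + 1 - b) / ((m + 1) * m) := by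
        field_simp
        ring
      rw [he2, div_le_iff₀ (by positivity)]
      linarith
    · convert hconv (hvert m hm1 (by omega)) (hvert (m + 1) (by omega) hmv) ha hb hab using 1
      ext
      · exact hxab.symm
      · rfl

/-! ### Sufficiency of the linear inequalities -/

open scoped Pointwise in
lemma mem_convexHull_boundedCoveringSet_of_le {n : ℕ} {r : ℝ} {u : Fin n → ℕ} {x y z : Fin n → ℝ}
    (h : ((x, z) : PairSpace n) ∈ convexHull ℝ (boundedCoveringSet r u)) (hzy : z ≤ y) :
    ((x, y) : PairSpace n) ∈ convexHull ℝ (boundedCoveringSet r u) := by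
  have hsub : ((0, y - z) : PairSpace n) +ᵥ boundedCoveringSet r u ⊆ boundedCoveringSet r u := by
    rintro _ ⟨q, ⟨hx, hy, hsum, hxu⟩, rfl⟩
    have hd : ∀ i, 0 ≤ y i - z i := fun i => sub_nonneg.2 (hzy i)
    have hx0 : ∀ i, 0 ≤ q.1 i := fun i => by
      obtain ⟨m, hm⟩ := hx i
      rw [hm]
      positivity
    refine ⟨by simpa using hx, fun i => by simpa using add_nonneg (hd i) (hy i),
      hsum.trans (Finset.sum_le_sum fun i _ => ?_), by simpa using hxu⟩
    simp only [vadd_eq_add, Prod.fst_add, Prod.snd_add, Pi.add_apply, Pi.sub_apply,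
      Pi.zero_apply, zero_add]
    exact mul_le_mul_of_nonneg_left (le_add_of_nonneg_left (hd i)) (hx0 i)
  have hmem : ((x, y) : PairSpace n) ∈
      ((0, y - z) : PairSpace n) +ᵥ convexHull ℝ (boundedCoveringSet r u) :=
    ⟨_, h, by simp⟩
  rw [← convexHull_vadd] at hmem
  exact convexHull_mono hsub hmem

/-- A point all of whose coordinate pairs are planar vertices is the average, with weights `tⱼ`, of
integral points with a single nonzero entry in `y`. -/
lemma vertex_mem_convexHull {n : ℕ} {r : ℝ} (hr : 0 < r) {u : Fin n → ℕ} {t : Fin n → ℝ}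
    (ht : ∀ i, 0 ≤ t i) (ht1 : ∑ i, t i = 1) {q : Fin n → ℝ × ℝ}
    (hq : ∀ i, q i ∈ planarVertices r (u i) (t i)) :
    ((fun i => (q i).1, fun i => (q i).2) : PairSpace n) ∈
      convexHull ℝ (boundedCoveringSet r u) := by
  classical
  choose m hm0 hmu hq2 hq1 using hq
  have hm0' : ∀ i, (0 : ℝ) < m i := fun i => by exact_mod_cast hm0 i
  -- The coordinates where `x` stays at the upper bound in every averaged point.
  let A : Fin n → Prop := fun i => (q i).1 ≠ t i * m i
  have hA : ∀ i, A i → m i = u i ∧ (q i).1 = u i := fun i h => (hq1 i).resolve_left h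
  let P : Fin n → PairSpace n := fun j =>
    (fun i => if A i ∨ i = j then (m i : ℝ) else 0, Pi.single j (r / m j))
  have hP : ∀ j, P j ∈ boundedCoveringSet r u := by
    intro j
    refine ⟨fun i => ?_, fun i => ?_, ?_, fun i => ?_⟩
    · by_cases h : A i ∨ i = j
      · exact ⟨m i, by simp only [P, if_pos h]⟩
      · exact ⟨0, by simp only [P, if_neg h, Nat.cast_zero]⟩
    · have : 0 ≤ r / m j := div_nonneg hr.le (hm0' j).le
      by_cases h : i = j
      · subst h
        simpa [P] using this
      · simp [P, h]
    · rw [Finset.sum_eq_single_of_mem j (Finset.mem_univ j) fun i _ hi => by simp [P, hi]]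
      simp [P, mul_div_cancel₀ r (hm0' j).ne']
    · by_cases h : A i ∨ i = j
      · simpa only [P, if_pos h] using Nat.cast_le.2 (hmu i)
      · simp only [P, if_neg h]
        positivity
  have hsum := (convex_convexHull ℝ (boundedCoveringSet r u)).sum_mem (t := Finset.univ)
    (fun j _ => ht j) ht1 (fun j _ => subset_convexHull ℝ _ (hP j))
  convert hsum using 1
  ext i
  · simp only [P, Prod.fst_sum, Prod.smul_fst, Finset.sum_apply, Pi.smul_apply, smul_eq_mul]
    by_cases h : A i
    · simp only [h, true_or, if_true]
      rw [← Finset.sum_mul, ht1, one_mul, (hA i h).1, (hA i h).2]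
    · have h' : (q i).1 = t i * m i := not_not.1 h
      simp [h, h']
  · simp [P, Prod.snd_sum, Pi.single_apply, hq2]

lemma mem_convexHull_of_one_le_sum_facetForm {n : ℕ} {r : ℝ} (hr : 0 < r) {u : Fin n → ℕ}
    (hu : ∀ i, 0 < u i) {p : PairSpace n}
    (hform : ∀ k : Fin n → ℕ, (∀ i, k i ∈ facetIndex (u i)) →
      1 ≤ ∑ i, facetForm r (u i) (k i) (p.1 i) (p.2 i))
    (hx : ∀ i, 0 ≤ p.1 i) (hxu : ∀ i, p.1 i ≤ (u i : ℝ)) (hy : ∀ i, 0 ≤ p.2 i) :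
    p ∈ convexHull ℝ (boundedCoveringSet r u) := by
  have hmin : ∀ i, ∃ k ∈ facetIndex (u i), ∀ l ∈ facetIndex (u i),
      facetForm r (u i) k (p.1 i) (p.2 i) ≤ facetForm r (u i) l (p.1 i) (p.2 i) := fun i =>
    Finset.exists_min_image _ _ ⟨1, mem_facetIndex.2 ⟨le_rfl, by omega⟩⟩
  choose k hk hkmin using hmin
  set g : Fin n → ℝ := fun i => facetForm r (u i) (k i) (p.1 i) (p.2 i) with hg
  have hg0 : ∀ i, 0 ≤ g i := fun i => facetForm_nonneg hr (hk i) (hx i) (hy i)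
  have hG : 1 ≤ ∑ i, g i := hform k hk
  have hG0 : 0 < ∑ i, g i := zero_lt_one.trans_le hG
  let t : Fin n → ℝ := fun i => g i / ∑ j, g j
  have ht : ∀ i, 0 ≤ t i := fun i => div_nonneg (hg0 i) hG0.le
  have ht1 : ∑ i, t i = 1 := by
    simp only [t]
    rw [← Finset.sum_div, div_self hG0.ne']
  have htg : ∀ i, t i ≤ g i := fun i => div_le_self (hg0 i) hG
  choose z hzy hz using fun i => exists_mem_convexHull_planarVertices hr (hu i) (ht i) (hxu i)
    fun l hl => (htg i).trans (hkmin i l hl)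
  let L : (Fin n → ℝ × ℝ) →ₗ[ℝ] PairSpace n :=
    { toFun := fun q => (fun i => (q i).1, fun i => (q i).2)
      map_add' := fun _ _ => rfl
      map_smul' := fun _ _ => rfl }
  have hpi : (fun i => (p.1 i, z i)) ∈
      convexHull ℝ (Set.univ.pi fun i => planarVertices r (u i) (t i)) := by
    rw [convexHull_pi]
    exact fun i _ => hz i
  have hmem : L (fun i => (p.1 i, z i)) ∈ convexHull ℝ (boundedCoveringSet r u) := by
    have h := Set.mem_image_of_mem L hpi
    rw [L.image_convexHull] at h
    refine convexHull_min ?_ (convex_convexHull ℝ _) h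
    rintro _ ⟨q, hq, rfl⟩
    exact vertex_mem_convexHull hr ht ht1 fun i => hq i trivial
  exact mem_convexHull_boundedCoveringSet_of_le hmem hzy

theorem mainTheorem1 (n : ℕ) (r : ℝ) (hr : 0 < r) (u : Fin n → ℕ) (hu : ∀ i, 0 < u i) :
    convexHull ℝ (boundedCoveringSet r u) =
        closure (convexHull ℝ (lowerBoundedSet r u)) ∩ boundBox u ∧
      convexHull ℝ (boundedCoveringSet r u) =
        {p : PairSpace n |
          (∀ k : Fin n → ℕ, (∀ i, k i ∈ facetIndex (u i)) →
            1 ≤ ∑ i, facetForm r (u i) (k i) (p.1 i) (p.2 i)) ∧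
          (∀ i, 0 ≤ p.1 i) ∧ (∀ i, p.1 i ≤ (u i : ℝ)) ∧ ∀ i, 0 ≤ p.2 i} := by
  have h1 : convexHull ℝ (boundedCoveringSet r u) ⊆
      closure (convexHull ℝ (lowerBoundedSet r u)) ∩ boundBox u := by
    refine convexHull_min (Set.subset_inter (boundedCoveringSet_subset_closure hr hu) ?_)
      ((convex_convexHull ℝ _).closure.inter (convex_boundBox u))
    rintro p ⟨hx, hy, -, hxu⟩
    refine ⟨fun i => ?_, hy, hxu⟩
    obtain ⟨m, hm⟩ := hx i
    rw [hm]
    positivity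
  have h2 : closure (convexHull ℝ (lowerBoundedSet r u)) ∩ boundBox u ⊆
      {p : PairSpace n |
        (∀ k : Fin n → ℕ, (∀ i, k i ∈ facetIndex (u i)) →
          1 ≤ ∑ i, facetForm r (u i) (k i) (p.1 i) (p.2 i)) ∧
        (∀ i, 0 ≤ p.1 i) ∧ (∀ i, p.1 i ≤ (u i : ℝ)) ∧ ∀ i, 0 ≤ p.2 i} :=
    fun p ⟨hp, hx, hy, hxu⟩ =>
      ⟨fun k hk => one_le_sum_facetForm_of_mem_closure hr hu hk hp, hx, hxu, hy⟩
  have h3 : {p : PairSpace n |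
        (∀ k : Fin n → ℕ, (∀ i, k i ∈ facetIndex (u i)) →
          1 ≤ ∑ i, facetForm r (u i) (k i) (p.1 i) (p.2 i)) ∧
        (∀ i, 0 ≤ p.1 i) ∧ (∀ i, p.1 i ≤ (u i : ℝ)) ∧ ∀ i, 0 ≤ p.2 i} ⊆
      convexHull ℝ (boundedCoveringSet r u) :=
    fun p ⟨hform, hx, hxu, hy⟩ => mem_convexHull_of_one_le_sum_facetForm hr hu hform hx hxu hy
  exact ⟨h1.antisymm (h2.trans h3), (h1.trans h2).antisymm h3⟩
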